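/- Let $D=(V,A)$, $A\subseteq V\times V$, be a finite minimal strong digraph, i.e. a finite strongly connected digraph such that deleting any single arc yields a digraph that is not strongly connected. Suppose that $D$ contains a directed cycle $C_q$ of length $q$ (with $q$ distinct vertices, not necessarily induced). Call a vertex of $D$ linear if its indegree and its outdegree are both equal to $1$, and let $\alpha$ be the number of linear vertices of $D$. Then $$\alpha \ge \left\lfloor \frac{q+1}{2}\right\rfloor .$$ -/

import Mathlib

namespace Digraph

/-- Every vertex can be reached from every vertex by a directed path (possibly of length zero). -/
def IsStrong {V : Type*} (D : Digraph V) : Prop :=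
  ∀ u v : V, Relation.ReflTransGen D.Adj u v

/-- The digraph obtained from `D` by deleting the arc `uv`, keeping all vertices. -/
def deleteArc {V : Type*} (D : Digraph V) (u v : V) : Digraph V where
  Adj a b := D.Adj a b ∧ ¬ (a = u ∧ b = v)

/-- A minimal strong digraph: a strong digraph in which the deletion of any arc yields a digraph
that is not strong. (In particular, such a digraph has no loops.) -/
def IsMinimalStrong {V : Type*} (D : Digraph V) : Prop :=
  D.IsStrong ∧ ∀ u v : V, D.Adj u v → ¬ (D.deleteArc u v).IsStrong

/-- The number of arcs leaving `v`. -/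
noncomputable def outdegree {V : Type*} (D : Digraph V) (v : V) : ℕ :=
  {w : V | D.Adj v w}.ncard

/-- The number of arcs entering `v`. -/
noncomputable def indegree {V : Type*} (D : Digraph V) (v : V) : ℕ :=
  {w : V | D.Adj w v}.ncard

/-- A linear vertex: indegree and outdegree are both `1`. -/
def IsLinearVertex {V : Type*} (D : Digraph V) (v : V) : Prop :=
  D.indegree v = 1 ∧ D.outdegree v = 1

/-- `c` lists, in cyclic order, the `q` distinct vertices of a directed cycle of length `q`
contained in `D` (not necessarily induced). -/
def IsDirectedCycle {V : Type*} (D : Digraph V) (q : ℕ) (c : ZMod q → V) : Prop :=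
  0 < q ∧ Function.Injective c ∧ ∀ i : ZMod q, D.Adj (c i) (c (i + 1))

end Digraph

open Relation

/-! Let S be the cycle's vertex set. Minimality forbids chords, so a vertex of S is linear unless an
arc joins it to the outside. By `ncard_exits_le` and its reversal `ncard_entries_le`, the linear
vertices outside S are at least as many as the exits of S, and as the entries; hence q ≤ |L ∩ S| +
2|L \ S| ≤ 2|L|. For exits: cutting an exit arc sy leaves a proper strong set reachable from S,
which misses a linear vertex (`exists_isLinearVertex_notMem`, by an ear argument); distinct s have
disjoint missed sets. -/

lemma Relation.ReflTransGen.of_imp {α : Type*} {r p : α → α → Prop} {a b : α}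
    (h : ReflTransGen r a b) (hrp : ∀ x y, r x y → p x y) : ReflTransGen p a b :=
  ReflTransGen.mono hrp a b h

namespace Digraph

variable {V : Type*}

/-- The arcs of `D` with both ends in `S`. -/
def ArcWithin (D : Digraph V) (S : Set V) (a b : V) : Prop :=
  D.Adj a b ∧ a ∈ S ∧ b ∈ S

/-- The subdigraph of `D` induced on `S` is strong. -/
def IsStrongOn (D : Digraph V) (S : Set V) : Prop :=
  ∀ u ∈ S, ∀ v ∈ S, ReflTransGen (D.ArcWithin S) u v

/-- The digraph obtained by reversing all arcs. -/
def reverse (D : Digraph V) : Digraph V where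
  Adj a b := D.Adj b a

lemma ArcWithin.mono {D : Digraph V} {S T : Set V} (h : S ⊆ T) {a b : V}
    (hab : D.ArcWithin S a b) : D.ArcWithin T a b :=
  ⟨hab.1, h hab.2.1, h hab.2.2⟩

/-- In a minimal strong digraph, the ends of an arc are not joined by a walk avoiding that arc. -/
lemma IsMinimalStrong.not_reflTransGen_deleteArc {D : Digraph V} (hD : D.IsMinimalStrong)
    {u v : V} (huv : D.Adj u v) : ¬ ReflTransGen (D.deleteArc u v).Adj u v := by
  intro h
  refine hD.2 u v huv fun a b => ?_
  induction hD.1 a b with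
  | refl => exact .refl
  | @tail x y _ hxy ih =>
    by_cases he : x = u ∧ y = v
    · rw [he.1] at ih
      rw [he.2]
      exact ih.trans h
    · exact ih.tail ⟨hxy, he⟩

/-- A strong spanning subrelation of a minimal strong digraph contains all arcs. -/
lemma IsMinimalStrong.rel_of_adj {D : Digraph V} (hD : D.IsMinimalStrong) {E : V → V → Prop}
    (hE : ∀ a b, E a b → D.Adj a b) (hs : ∀ a b, ReflTransGen E a b) {u v : V}
    (huv : D.Adj u v) : E u v := by
  by_contra hne
  refine hD.not_reflTransGen_deleteArc huv ((hs u v).of_imp fun a b hab => ⟨hE a b hab, ?_⟩)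
  rintro ⟨rfl, rfl⟩
  exact hne hab

/-- In a strong digraph there is a rank function decreasing along some arc at each vertex
outside a given nonempty set. -/
lemma IsStrong.exists_rank {D : Digraph V} (hD : D.IsStrong) {T : Set V} (hT : T.Nonempty) :
    ∃ d : V → ℕ, ∀ v, v ∉ T → ∃ w, D.Adj v w ∧ d w < d v := by
  classical
  obtain ⟨t, ht⟩ := hT
  -- `L n`: vertices with a walk of length n into T. The rank is thus the distance to T.
  let L : ℕ → Set V := Nat.rec (motive := fun _ => Set V) T (fun _ s => {v | ∃ w ∈ s, D.Adj v w})
  have hL : ∀ v, ∃ n, v ∈ L n := by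
    intro v
    induction hD v t using ReflTransGen.head_induction_on with
    | refl => exact ⟨0, ht⟩
    | head hab _ ih =>
      obtain ⟨n, hn⟩ := ih
      exact ⟨n + 1, _, hn, hab⟩
  refine ⟨fun v => Nat.find (hL v), fun v hv => ?_⟩
  have hs := Nat.find_spec (hL v)
  rcases hn : Nat.find (hL v) with _ | m
  · rw [hn] at hs
    exact absurd hs hv
  · rw [hn] at hs
    obtain ⟨w, hw, hvw⟩ := hs
    refine ⟨w, hvw, ?_⟩
    have := Nat.find_min' (hL w) (m := m) hw
    simp only [hn]
    omega

lemma exists_adj_of_reflTransGen {r : V → V → Prop} {T : Set V} {a b : V}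
    (h : ReflTransGen r a b) (ha : a ∈ T) (hb : b ∉ T) : ∃ x ∈ T, ∃ y, y ∉ T ∧ r x y := by
  induction h with
  | refl => exact absurd ha hb
  | @tail x y _ hxy ih =>
    by_cases hx : x ∈ T
    · exact ⟨x, hx, y, hb, hxy⟩
    · exact ih hx

lemma isLinearVertex_of_unique {D : Digraph V} {v a b : V} (hav : D.Adj a v) (hvb : D.Adj v b)
    (ha : ∀ w, D.Adj w v → w = a) (hb : ∀ w, D.Adj v w → w = b) : D.IsLinearVertex v := by
  constructor
  · exact Set.ncard_eq_one.2 ⟨a, Set.ext fun w => ⟨ha w, fun h => h ▸ hav⟩⟩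
  · exact Set.ncard_eq_one.2 ⟨b, Set.ext fun w => ⟨hb w, fun h => h ▸ hvb⟩⟩

/-- Outside a maximal proper strong set the digraph is a single ear, whose first vertex is
linear. -/
lemma IsMinimalStrong.exists_isLinearVertex_of_maximal {D : Digraph V} (hD : D.IsMinimalStrong)
    {T : Set V} (hne : T.Nonempty) (hT : D.IsStrongOn T) (hu : T ≠ Set.univ)
    (hmax : ∀ T', T ⊂ T' → D.IsStrongOn T' → T' = Set.univ) :
    ∃ v, v ∉ T ∧ D.IsLinearVertex v := by
  obtain ⟨d, hd⟩ := hD.1.exists_rank hne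
  obtain ⟨t, ht⟩ := hne
  obtain ⟨z, hz⟩ := (Set.ne_univ_iff_exists_notMem T).1 hu
  obtain ⟨s, hs, v₁, hv₁, hsv⟩ := exists_adj_of_reflTransGen (hD.1 t z) ht hz
  choose! nxt hadj hlt using hd
  -- Following `nxt` from `v₁` traces an ear back to T.
  let N : V → V → Prop := fun a b => a ∉ T ∧ b = nxt a
  let T' : Set V := T ∪ {v | ReflTransGen N v₁ v}
  let E : V → V → Prop := fun a b => D.ArcWithin T a b ∨ (a = s ∧ b = v₁) ∨ N a b
  have hEadj : ∀ a b, E a b → D.Adj a b := by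
    rintro a b (h | ⟨rfl, rfl⟩ | ⟨h, rfl⟩)
    exacts [h.1, hsv, hadj a h]
  have hv₁' : v₁ ∈ T' := Or.inr .refl
  let F : V → V → Prop := fun a b => E a b ∧ a ∈ T' ∧ b ∈ T'
  have hTT : ∀ a ∈ T, ∀ b ∈ T, ReflTransGen F a b := fun a ha b hb =>
    (hT a ha b hb).of_imp fun x y hxy => ⟨Or.inl hxy, Or.inl hxy.2.1, Or.inl hxy.2.2⟩
  have hfrom : ∀ b ∈ T', ReflTransGen F s b := by
    rintro b (hb | hb)
    · exact hTT s hs b hb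
    · refine .head (b := v₁) ⟨Or.inr (Or.inl ⟨rfl, rfl⟩), Or.inl hs, hv₁'⟩ ?_
      induction hb with
      | refl => exact .refl
      | tail h1 h2 ih => exact ih.tail ⟨Or.inr (Or.inr h2), Or.inr h1, Or.inr (h1.tail h2)⟩
  have hto : ∀ n, ∀ a ∈ T', d a = n → ReflTransGen F a s := by
    intro n
    induction n using Nat.strong_induction_on with
    | _ n ih =>
      intro a ha hn
      by_cases haT : a ∈ T
      · exact hTT a haT s hs
      · have hr : ReflTransGen N v₁ a := ha.resolve_left haT
        have hN : N a (nxt a) := ⟨haT, rfl⟩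
        have hm : nxt a ∈ T' := Or.inr (hr.tail hN)
        exact .head ⟨Or.inr (Or.inr hN), ha, hm⟩ (ih _ (hn ▸ hlt a haT) _ hm rfl)
  have hF : ∀ a ∈ T', ∀ b ∈ T', ReflTransGen F a b := fun a ha b hb =>
    (hto _ a ha rfl).trans (hfrom b hb)
  have hT'u : T' = Set.univ := by
    refine hmax T' ⟨Set.subset_union_left, fun h => hv₁ (h hv₁')⟩ fun a ha b hb => ?_
    exact (hF a ha b hb).of_imp fun x y hxy => ⟨hEadj x y hxy.1, hxy.2⟩
  have hmem : ∀ a, a ∈ T' := fun a => hT'u ▸ Set.mem_univ a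
  have hE : ∀ {a b}, D.Adj a b → E a b := fun h => hD.rel_of_adj hEadj
    (fun a b => (hF a (hmem a) b (hmem b)).of_imp fun _ _ h => h.1) h
  have hle : ∀ w, ReflTransGen N v₁ w → d w ≤ d v₁ := by
    intro w hw
    induction hw with
    | refl => exact le_rfl
    | tail _ h2 ih =>
      obtain ⟨h2, rfl⟩ := h2
      exact (hlt _ h2).le.trans ih
  refine ⟨v₁, hv₁, isLinearVertex_of_unique hsv (hadj v₁ hv₁) (fun w hw => ?_) (fun w hw => ?_)⟩
  · rcases hE hw with h | h | ⟨h, h'⟩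
    · exact absurd h.2.2 hv₁
    · exact h.1
    -- Ranks never exceed `d v₁` along the ear, so no ear arc re-enters `v₁`.
    · have h1 := hlt w h
      have h2 := hle w ((hmem w).resolve_left h)
      rw [← h'] at h1
      omega
  · rcases hE hw with h | h | h
    · exact absurd h.2.1 hv₁
    · exact absurd (h.1 ▸ hs) hv₁
    · exact h.2

/-- Every proper strong vertex set of a minimal strong digraph misses a linear vertex. -/
lemma IsMinimalStrong.exists_isLinearVertex_notMem [Finite V] {D : Digraph V}
    (hD : D.IsMinimalStrong) {S : Set V} (hne : S.Nonempty) (hS : D.IsStrongOn S)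
    (hu : S ≠ Set.univ) : ∃ v, v ∉ S ∧ D.IsLinearVertex v := by
  obtain ⟨T, hST, hT⟩ := (Set.toFinite {T : Set V | D.IsStrongOn T ∧ T ≠ Set.univ}).exists_le_maximal
    (a := S) ⟨hS, hu⟩
  obtain ⟨v, hv, hl⟩ := hD.exists_isLinearVertex_of_maximal (hne.mono hST) hT.prop.1 hT.prop.2
    fun T' hTT' hT' => by
      by_contra h
      exact hTT'.2 (hT.le_of_ge ⟨hT', h⟩ hTT'.1)
  exact ⟨v, fun h => hv (hST h), hl⟩

/-! ### Cutting one exit arc -/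

/-- The vertices reachable from `S` without using the arc `sy`. -/
def reachAvoiding (D : Digraph V) (S : Set V) (s y : V) : Set V :=
  {v | ∃ u ∈ S, ReflTransGen (D.deleteArc s y).Adj u v}

lemma subset_reachAvoiding (D : Digraph V) (S : Set V) (s y : V) :
    S ⊆ D.reachAvoiding S s y := fun u hu => ⟨u, hu, .refl⟩

lemma mem_reachAvoiding_of_adj {D : Digraph V} {S : Set V} {s y a b : V}
    (ha : a ∈ D.reachAvoiding S s y) (hab : D.Adj a b) (h : ¬ (a = s ∧ b = y)) :
    b ∈ D.reachAvoiding S s y := by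
  obtain ⟨u, hu, hua⟩ := ha
  exact ⟨u, hu, hua.tail ⟨hab, h⟩⟩

/-- A walk towards s stays in the set until it meets the cut arc, whose tail s is already in S. -/
lemma IsStrongOn.reachAvoiding {D : Digraph V} (hD : D.IsStrong) {S : Set V}
    (hS : D.IsStrongOn S) {s y : V} (hs : s ∈ S) : D.IsStrongOn (D.reachAvoiding S s y) := by
  set T := D.reachAvoiding S s y
  have hST : S ⊆ T := D.subset_reachAvoiding S s y
  have hto : ∀ a ∈ T, ∃ t ∈ S, ReflTransGen (D.ArcWithin T) a t := by
    intro a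
    induction hD a s using ReflTransGen.head_induction_on with
    | refl => exact fun _ => ⟨s, hs, .refl⟩
    | @head a b hab _ ih =>
      intro ha
      by_cases h : a = s ∧ b = y
      · exact ⟨a, h.1 ▸ hs, .refl⟩
      · have hb : b ∈ T := mem_reachAvoiding_of_adj ha hab h
        obtain ⟨t, ht, hbt⟩ := ih hb
        exact ⟨t, ht, .head ⟨hab, ha, hb⟩ hbt⟩
  rintro a ha b ⟨u, hu, hub⟩
  obtain ⟨t, ht, hat⟩ := hto a ha
  refine hat.trans (((hS t ht u hu).of_imp fun _ _ h => h.mono hST).trans ?_)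
  induction hub with
  | refl => exact .refl
  | tail h1 h2 ih => exact ih.tail ⟨h2.1, ⟨u, hu, h1⟩, ⟨u, hu, h1.tail h2⟩⟩

lemma IsMinimalStrong.notMem_reachAvoiding {D : Digraph V} (hD : D.IsMinimalStrong) {S : Set V}
    (hS : D.IsStrongOn S) {s y : V} (hs : s ∈ S) (hy : y ∉ S) (hsy : D.Adj s y) :
    y ∉ D.reachAvoiding S s y := by
  rintro ⟨u, hu, huy⟩
  refine hD.not_reflTransGen_deleteArc hsy (.trans ((hS s hs u hu).of_imp fun a b h => ?_) huy)
  exact ⟨h.1, fun he => hy (he.2 ▸ h.2.2)⟩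

/-- Each cut arc starts in S and remains usable for the other set, so the two complements are
disjoint. -/
lemma mem_reachAvoiding_or {D : Digraph V} (hD : D.IsStrong) {S : Set V} {s y s' y' : V}
    (hs : s ∈ S) (hs' : s' ∈ S) (hne : s ≠ s') (v : V) :
    v ∈ D.reachAvoiding S s y ∨ v ∈ D.reachAvoiding S s' y' := by
  induction hD s v with
  | refl => exact Or.inl (D.subset_reachAvoiding S s y hs)
  | @tail a b _ hab ih =>
    by_cases h : a = s ∧ b = y
    · refine Or.inr (mem_reachAvoiding_of_adj (D.subset_reachAvoiding _ _ _ (h.1 ▸ hs)) hab ?_)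
      exact fun h' => hne (h.1.symm.trans h'.1)
    by_cases h' : a = s' ∧ b = y'
    · exact Or.inl (mem_reachAvoiding_of_adj (D.subset_reachAvoiding _ _ _ (h'.1 ▸ hs')) hab h)
    exact ih.imp (mem_reachAvoiding_of_adj · hab h) (mem_reachAvoiding_of_adj · hab h')

/-- There are at least as many linear vertices outside a strong set `S` as vertices of `S` with
an arc leaving `S`. -/
lemma IsMinimalStrong.ncard_exits_le [Finite V] {D : Digraph V} (hD : D.IsMinimalStrong)
    {S : Set V} (hS : D.IsStrongOn S) :
    {s ∈ S | ∃ y, y ∉ S ∧ D.Adj s y}.ncard ≤ ({v | D.IsLinearVertex v} \ S).ncard := by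
  have key : ∀ s ∈ {s ∈ S | ∃ y, y ∉ S ∧ D.Adj s y},
      ∃ y v, v ∉ D.reachAvoiding S s y ∧ D.IsLinearVertex v := by
    rintro s ⟨hs, y, hy, hsy⟩
    obtain ⟨v, hv⟩ := hD.exists_isLinearVertex_notMem
      ⟨s, D.subset_reachAvoiding S s y hs⟩ (hS.reachAvoiding hD.1 hs (y := y))
      ((Set.ne_univ_iff_exists_notMem _).2 ⟨y, hD.notMem_reachAvoiding hS hs hy hsy⟩)
    exact ⟨y, v, hv⟩
  choose! y f hf hl using key
  refine Set.ncard_le_ncard_of_injOn f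
    (fun s hs => ⟨hl s hs, fun h => hf s hs (D.subset_reachAvoiding _ _ _ h)⟩)
    (fun s hs s' hs' he => ?_)
  by_contra hne
  rcases mem_reachAvoiding_or hD.1 hs.1 hs'.1 hne (y := y s) (y' := y s') (f s) with h | h
  · exact hf s hs h
  · exact hf s' hs' (he ▸ h)

lemma isMinimalStrong_reverse {D : Digraph V} (hD : D.IsMinimalStrong) :
    D.reverse.IsMinimalStrong := by
  refine ⟨fun u v => (hD.1 v u).swap, fun u v huv h => hD.2 v u huv fun a b => ?_⟩
  exact (h b a).swap.of_imp fun x y hxy => ⟨hxy.1, fun he => hxy.2 he.symm⟩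

lemma isStrongOn_reverse {D : Digraph V} {S : Set V} (hS : D.IsStrongOn S) :
    D.reverse.IsStrongOn S := fun u hu v hv =>
  (hS v hv u hu).swap.of_imp fun _ _ h => ⟨h.1, h.2.2, h.2.1⟩

lemma isLinearVertex_reverse_iff {D : Digraph V} {v : V} :
    D.reverse.IsLinearVertex v ↔ D.IsLinearVertex v := and_comm

/-- There are at least as many linear vertices outside a strong set `S` as vertices of `S` with
an arc coming from outside `S`. -/
lemma IsMinimalStrong.ncard_entries_le [Finite V] {D : Digraph V} (hD : D.IsMinimalStrong)
    {S : Set V} (hS : D.IsStrongOn S) :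
    {s ∈ S | ∃ y, y ∉ S ∧ D.Adj y s}.ncard ≤ ({v | D.IsLinearVertex v} \ S).ncard := by
  have h := (isMinimalStrong_reverse hD).ncard_exits_le (isStrongOn_reverse hS)
  simp only [isLinearVertex_reverse_iff] at h
  exact h

/-! ### Directed cycles -/

/-- The arcs of a directed cycle connect any two of its vertices. -/
lemma reflTransGen_cycle {q : ℕ} (hq : 0 < q) (c : ZMod q → V) (i j : ZMod q) :
    ReflTransGen (fun a b => ∃ k, a = c k ∧ b = c (k + 1)) (c i) (c j) := by
  have : NeZero q := ⟨hq.ne'⟩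
  have h : ∀ n : ℕ, ReflTransGen (fun a b => ∃ k, a = c k ∧ b = c (k + 1))
      (c i) (c (i + n)) := by
    intro n
    induction n with
    | zero => simpa using ReflTransGen.refl
    | succ n ih => exact ih.tail ⟨_, rfl, by push_cast; rw [add_assoc]⟩
  simpa using h (j - i).val

lemma IsDirectedCycle.isStrongOn_range {D : Digraph V} {q : ℕ} {c : ZMod q → V}
    (hc : D.IsDirectedCycle q c) : D.IsStrongOn (Set.range c) := by
  rintro _ ⟨i, rfl⟩ _ ⟨j, rfl⟩
  refine (reflTransGen_cycle hc.1 c i j).of_imp ?_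
  rintro _ _ ⟨k, rfl, rfl⟩
  exact ⟨hc.2.2 k, ⟨k, rfl⟩, ⟨k + 1, rfl⟩⟩

/-- Directed cycles of a minimal strong digraph have no chords. -/
lemma IsDirectedCycle.eq_add_one_of_adj {D : Digraph V} (hD : D.IsMinimalStrong) {q : ℕ}
    {c : ZMod q → V} (hc : D.IsDirectedCycle q c) {i j : ZMod q} (h : D.Adj (c i) (c j)) :
    j = i + 1 := by
  by_contra hne
  refine hD.not_reflTransGen_deleteArc h ((reflTransGen_cycle hc.1 c i j).of_imp ?_)
  rintro _ _ ⟨k, rfl, rfl⟩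
  refine ⟨hc.2.2 k, fun ⟨h1, h2⟩ => hne ?_⟩
  rw [← hc.2.1 h1, ← hc.2.1 h2]

lemma IsDirectedCycle.isLinearVertex {D : Digraph V} (hD : D.IsMinimalStrong) {q : ℕ}
    {c : ZMod q → V} (hc : D.IsDirectedCycle q c) {i : ZMod q}
    (hout : ∀ y, D.Adj (c i) y → y ∈ Set.range c) (hin : ∀ y, D.Adj y (c i) → y ∈ Set.range c) :
    D.IsLinearVertex (c i) := by
  have hpred : D.Adj (c (i - 1)) (c i) := by simpa using hc.2.2 (i - 1)
  refine isLinearVertex_of_unique hpred (hc.2.2 i) (fun w hw => ?_) (fun w hw => ?_)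
  · obtain ⟨j, rfl⟩ := hin w hw
    rw [hc.eq_add_one_of_adj hD hw, add_sub_cancel_right]
  · obtain ⟨j, rfl⟩ := hout w hw
    rw [hc.eq_add_one_of_adj hD hw]

end Digraph

theorem theorem4 {V : Type*} [Finite V] (D : Digraph V) (hD : D.IsMinimalStrong)
    (q : ℕ) (c : ZMod q → V) (hc : D.IsDirectedCycle q c) :
    (q + 1) / 2 ≤ {v : V | D.IsLinearVertex v}.ncard := by
  have hcard : (Set.range c).ncard = q := by
    rw [← Set.image_univ, Set.ncard_image_of_injective _ hc.2.1, Set.ncard_univ, Nat.card_zmod]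
  have hS := hc.isStrongOn_range
  set S := Set.range c
  set L := {v : V | D.IsLinearVertex v}
  have hsub : S ⊆ (L ∩ S) ∪
      ({s ∈ S | ∃ y, y ∉ S ∧ D.Adj s y} ∪ {s ∈ S | ∃ y, y ∉ S ∧ D.Adj y s}) := by
    rintro _ ⟨i, rfl⟩
    by_cases h1 : ∃ y, y ∉ S ∧ D.Adj (c i) y
    · exact Or.inr (Or.inl ⟨⟨i, rfl⟩, h1⟩)
    by_cases h2 : ∃ y, y ∉ S ∧ D.Adj y (c i)
    · exact Or.inr (Or.inr ⟨⟨i, rfl⟩, h2⟩)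
    refine Or.inl ⟨hc.isLinearVertex hD (fun y hy => ?_) (fun y hy => ?_), ⟨i, rfl⟩⟩
    · by_contra h
      exact h1 ⟨y, h, hy⟩
    · by_contra h
      exact h2 ⟨y, h, hy⟩
  have h0 := Set.ncard_le_ncard hsub
  have h1 := Set.ncard_union_le (L ∩ S)
    ({s ∈ S | ∃ y, y ∉ S ∧ D.Adj s y} ∪ {s ∈ S | ∃ y, y ∉ S ∧ D.Adj y s})
  have h2 := Set.ncard_union_le {s ∈ S | ∃ y, y ∉ S ∧ D.Adj s y} {s ∈ S | ∃ y, y ∉ S ∧ D.Adj y s}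
  have h3 := hD.ncard_exits_le hS
  have h4 := hD.ncard_entries_le hS
  have h5 := Set.ncard_inter_add_ncard_sdiff_eq_ncard L S
  change _ ≤ (L \ S).ncard at h3
  change _ ≤ (L \ S).ncard at h4
  omega
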